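/- All metric conventions are as follows. A metric space $X$ embeds coarsely into Hilbert space if there are a real Hilbert space $E$, a map $F:X\to E$ and non-decreasing functions $\rho_\pm:[0,\infty)\to[0,\infty)$ with $\lim_{t\to\infty}\rho_\pm(t)=\infty$ and $\rho_-(d(x,x'))\le\|F(x)-F(x')\|\le\rho_+(d(x,x'))$ for all $x,x'\in X$. Let $L$ be a group with a finite generating set $S$, and let $K_0\ge K_1\ge K_2\ge\cdots$ be a nested sequence of finite-index normal subgroups of $L$ with $\bigcap_i K_i=1$. Let $d_i$ be the word metric on $L/K_i$ given by the image of $S$ (the path metric of the Cayley graph), let $e_i$ be the identity of $L/K_i$, and choose real numbers $g_i>\max(\operatorname{diam}L/K_i,\operatorname{diam}L/K_{i+1})$. The box space $\Box_{\{K_i\}}L$ (for $S$ and $(g_i)$) is the disjoint union $\bigsqcup_i L/K_i$ with the metric that is $d_i$ on $L/K_i$ and satisfies $$d(\alpha,\beta)=d_i(\alpha,e_i)+\sum_{k=i}^{j-1}g_k+d_j(e_j,\beta)\qquad(\alpha\in L/K_i,\ \beta\in L/K_j,\ i<j).$$ A discrete group $G$ is amenable if for every finite $A\subseteq G$ and every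 $\varepsilon>0$ there is a nonempty finite $F\subseteq G$ with $|aF\,\triangle\,F|\le\varepsilon|F|$ for all $a\in A$. **Theorem.** Let $H$ and $G$ be finitely generated residually finite groups, with $G$ amenable, and let $\Gamma=H\rtimes G$ be a semidirect product, for any action of $G$ on $H$ by automorphisms. Suppose that $H$ has a nested sequence $(N_i)$ of finite-index characteristic subgroups with $\bigcap_i N_i=1$ such that the box space $\Box_{\{N_i\}}H$, for some finite generating set of $H$ and some admissible choice of the distances $g_i$, embeds coarsely into Hilbert space. Then $\Gamma$ has a box space which embeds coarsely into Hilbert space: there is a nested sequence $(K_i)$ of finite-index normal subgroups of $\Gamma$ with $\bigcap_i K_i=1$ such that, for every finite generating set of $\Gamma$ and every admissible choice of the distances $g_i$, the box space $\Box_{\{K_i\}}\Gamma$ embeds coarsely into Hilbert space. -/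

import Mathlib

open Filter
open scoped NNReal Pointwise symmDiff

/-- A metric space `X` is coarsely embeddable in a metric space `Y` if there are a map `F : X → Y`
and non-decreasing functions `ρ₋, ρ₊ : [0, ∞) → [0, ∞)` tending to infinity such that
`ρ₋ (d (x, x')) ≤ d (F x, F x') ≤ ρ₊ (d (x, x'))` for all `x, x'`. -/
def CoarselyEmbeddable (X Y : Type*) [MetricSpace X] [MetricSpace Y] : Prop :=
  ∃ (F : X → Y) (ρl ρu : ℝ≥0 → ℝ≥0), Monotone ρl ∧ Monotone ρu ∧
    Tendsto ρl atTop atTop ∧ Tendsto ρu atTop atTop ∧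
    ∀ x x' : X, ρl (nndist x x') ≤ nndist (F x) (F x') ∧
      nndist (F x) (F x') ≤ ρu (nndist x x')

/-- `X` coarsely embeds into some real Hilbert space. -/
def CoarselyEmbedsIntoHilbert.{u} (X : Type u) [MetricSpace X] : Prop :=
  ∃ (E : Type u) (_ : NormedAddCommGroup E) (_ : InnerProductSpace ℝ E) (_ : CompleteSpace E),
    CoarselyEmbeddable X E

/-- Amenability of a discrete group, by the Følner condition: for every finite set `A` of group
elements and every `ε > 0` there is a nonempty finite set `F` with `|aF ∆ F| ≤ ε |F|` for all
`a ∈ A`. -/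
def Group.IsAmenable (G : Type*) [Group G] : Prop :=
  ∀ (A : Set G), A.Finite → ∀ ε : ℝ, 0 < ε →
    ∃ F : Set G, F.Finite ∧ F.Nonempty ∧
      ∀ a ∈ A, (((a • F) ∆ F).ncard : ℝ) ≤ ε * (F.ncard : ℝ)

section BoxSpace

variable {G : Type*} [Group G]

/-- The Cayley graph of `G ⧸ K` with respect to the image of the set `S`. -/
def quotientCayley (K : FiniteIndexNormalSubgroup G) (S : Set G) :
    SimpleGraph (G ⧸ K.toSubgroup) :=
  SimpleGraph.mulCayley ((QuotientGroup.mk' K.toSubgroup) '' S)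

/-- If `S` generates `G`, then the Cayley graphs of the quotients are connected, so that their
graph distance is a metric: the word metric for the image of `S`. -/
theorem quotientCayley_connected (K : FiniteIndexNormalSubgroup G) {S : Set G}
    (hS : Subgroup.closure S = ⊤) : (quotientCayley K S).Connected := by
  have step : ∀ (g : G), g ∈ S → ∀ q : G ⧸ K.toSubgroup,
      (quotientCayley K S).Reachable q (q * (QuotientGroup.mk' K.toSubgroup g)) := by
    intro g hg q
    by_cases h : q = q * (QuotientGroup.mk' K.toSubgroup g)
    · rw [← h]
    · refine SimpleGraph.Adj.reachable ?_
      rw [quotientCayley, SimpleGraph.mulCayley_adj']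
      exact ⟨h, _, ⟨g, hg, rfl⟩, Or.inl rfl⟩
  have key : ∀ g : G, ∀ q : G ⧸ K.toSubgroup,
      (quotientCayley K S).Reachable q (q * (QuotientGroup.mk' K.toSubgroup g)) := by
    intro g
    have hg : g ∈ Subgroup.closure S := by rw [hS]; trivial
    induction hg using Subgroup.closure_induction with
    | mem x hx => exact step x hx
    | one => intro q; rw [map_one, mul_one]
    | mul x y _ _ hx hy =>
      intro q
      rw [map_mul, ← mul_assoc]
      exact (hx q).trans (hy _)
    | inv x _ hx =>
      intro q
      have := (hx (q * (QuotientGroup.mk' K.toSubgroup x⁻¹))).symm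
      rwa [mul_assoc, ← map_mul, inv_mul_cancel, map_one, mul_one] at this
  refine (SimpleGraph.connected_iff _).2 ⟨?_, ⟨1⟩⟩
  intro x y
  obtain ⟨g, hg⟩ := QuotientGroup.mk'_surjective K.toSubgroup (x⁻¹ * y)
  have := key g x
  rwa [hg, mul_inv_cancel_left] at this

/-- `gap i` is an admissible distance between the identity elements of the successive quotients
`G ⧸ K i` and `G ⧸ K (i + 1)`: it is greater than the maximum of their diameters. -/
def IsBoxGap (K : ℕ → FiniteIndexNormalSubgroup G) (S : Set G) (gap : ℕ → ℝ) : Prop :=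
  ∀ i, ((max (quotientCayley (K i) S).diam (quotientCayley (K (i + 1)) S).diam : ℕ) : ℝ) < gap i

/-- The position of the identity element of `G ⧸ K i` on the thread; for `i ≤ j` the distance
`|boxPos gap i - boxPos gap j|` is `∑ k ∈ Finset.Ico i j, gap k`. -/
def boxPos (gap : ℕ → ℝ) (i : ℕ) : ℝ := ∑ k ∈ Finset.range i, gap k

/-- The box space distance on the disjoint union of the quotients `G ⧸ K i`: the word metric inside
each quotient, and `d (α, e_i) + d (e_i, e_j) + d (e_j, β)` for `α ∈ G ⧸ K i`, `β ∈ G ⧸ K j`,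
`i ≠ j`. -/
noncomputable def boxDist (K : ℕ → FiniteIndexNormalSubgroup G) (S : Set G) (gap : ℕ → ℝ) :
    (Σ i, G ⧸ (K i).toSubgroup) → (Σ i, G ⧸ (K i).toSubgroup) → ℝ
  | ⟨i, x⟩, ⟨j, y⟩ =>
    if h : i = j then ((quotientCayley (K j) S).dist (h ▸ x) y : ℝ)
    else ((quotientCayley (K i) S).dist x 1 : ℝ) + |boxPos gap i - boxPos gap j| +
      ((quotientCayley (K j) S).dist 1 y : ℝ)

/-- The box space of `G` corresponding to the sequence `K`, the generating set `S` and the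
distances `gap` between successive quotients; it carries the metric `boxDist K S gap`. -/
def BoxSpace (K : ℕ → FiniteIndexNormalSubgroup G) (S : Set G) (gap : ℕ → ℝ)
    (_hS : Subgroup.closure S = ⊤) (_hgap : IsBoxGap K S gap) :=
  Σ i, G ⧸ (K i).toSubgroup

theorem boxDist_same (K : ℕ → FiniteIndexNormalSubgroup G) (S : Set G) (gap : ℕ → ℝ) (i : ℕ)
    (x y : G ⧸ (K i).toSubgroup) :
    boxDist K S gap ⟨i, x⟩ ⟨i, y⟩ = ((quotientCayley (K i) S).dist x y : ℝ) := by
  simp [boxDist]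

theorem boxDist_ne (K : ℕ → FiniteIndexNormalSubgroup G) (S : Set G) (gap : ℕ → ℝ) {i j : ℕ}
    (h : i ≠ j) (x : G ⧸ (K i).toSubgroup) (y : G ⧸ (K j).toSubgroup) :
    boxDist K S gap ⟨i, x⟩ ⟨j, y⟩ = ((quotientCayley (K i) S).dist x 1 : ℝ) +
      |boxPos gap i - boxPos gap j| + ((quotientCayley (K j) S).dist 1 y : ℝ) := by
  simp [boxDist, h]

theorem IsBoxGap.pos {K : ℕ → FiniteIndexNormalSubgroup G} {S : Set G} {gap : ℕ → ℝ}
    (h : IsBoxGap K S gap) (i : ℕ) : 0 < gap i :=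
  lt_of_le_of_lt (Nat.cast_nonneg _) (h i)

theorem IsBoxGap.boxPos_injective {K : ℕ → FiniteIndexNormalSubgroup G} {S : Set G} {gap : ℕ → ℝ}
    (h : IsBoxGap K S gap) : Function.Injective (boxPos gap) := by
  refine (strictMono_nat_of_lt_succ fun i => ?_).injective
  rw [boxPos, boxPos, Finset.sum_range_succ]
  linarith [h.pos i]

noncomputable instance BoxSpace.instMetricSpace (K : ℕ → FiniteIndexNormalSubgroup G) (S : Set G)
    (gap : ℕ → ℝ) (hS : Subgroup.closure S = ⊤) (hgap : IsBoxGap K S gap) :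
    MetricSpace (BoxSpace K S gap hS hgap) where
  dist := boxDist K S gap
  dist_self := by
    rintro ⟨i, x⟩
    change boxDist K S gap _ _ = 0
    simp [boxDist_same]
  dist_comm := by
    rintro ⟨i, x⟩ ⟨j, y⟩
    change boxDist K S gap _ _ = boxDist K S gap _ _
    by_cases h : i = j
    · subst h
      simp only [boxDist_same, SimpleGraph.dist_comm]
    · rw [boxDist_ne K S gap h, boxDist_ne K S gap (Ne.symm h), abs_sub_comm,
        SimpleGraph.dist_comm (u := x), SimpleGraph.dist_comm (v := y)]
      ring
  dist_triangle := by
    have tri : ∀ i (a b c : G ⧸ (K i).toSubgroup), ((quotientCayley (K i) S).dist a c : ℝ) ≤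
        (quotientCayley (K i) S).dist a b + (quotientCayley (K i) S).dist b c := fun i a b c => by
      exact_mod_cast (quotientCayley_connected (K i) hS).dist_triangle
    have nn : ∀ i (a b : G ⧸ (K i).toSubgroup), (0 : ℝ) ≤ (quotientCayley (K i) S).dist a b :=
      fun i a b => Nat.cast_nonneg _
    rintro ⟨i, x⟩ ⟨j, y⟩ ⟨k, z⟩
    change boxDist K S gap _ _ ≤ boxDist K S gap _ _ + boxDist K S gap _ _
    by_cases hij : i = j
    · subst hij
      by_cases hik : i = k
      · subst hik
        simp only [boxDist_same]
        exact tri i x y z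
      · rw [boxDist_ne K S gap hik, boxDist_ne K S gap hik, boxDist_same]
        linarith [tri i x y 1]
    · by_cases hjk : j = k
      · subst hjk
        rw [boxDist_ne K S gap hij, boxDist_ne K S gap hij, boxDist_same]
        linarith [tri j 1 y z]
      · rw [boxDist_ne K S gap hij, boxDist_ne K S gap hjk]
        have h1 := nn j 1 y
        have h2 := nn j y 1
        by_cases hik : i = k
        · subst hik
          rw [boxDist_same]
          linarith [tri i x 1 z, abs_nonneg (boxPos gap i - boxPos gap j),
            abs_nonneg (boxPos gap j - boxPos gap i)]
        · rw [boxDist_ne K S gap hik]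
          linarith [abs_sub_le (boxPos gap i) (boxPos gap j) (boxPos gap k)]
  eq_of_dist_eq_zero := by
    rintro ⟨i, x⟩ ⟨j, y⟩ h
    change boxDist K S gap _ _ = 0 at h
    by_cases hij : i = j
    · subst hij
      rw [boxDist_same, Nat.cast_eq_zero,
        (quotientCayley_connected (K i) hS).dist_eq_zero_iff] at h
      rw [h]
    · exfalso
      rw [boxDist_ne K S gap hij] at h
      have h1 : 0 < |boxPos gap i - boxPos gap j| :=
        abs_pos.2 (sub_ne_zero.2 fun e => hij (hgap.boxPos_injective e))
      have h2 : (0 : ℝ) ≤ (quotientCayley (K i) S).dist x 1 := Nat.cast_nonneg _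
      have h3 : (0 : ℝ) ≤ (quotientCayley (K j) S).dist 1 y := Nat.cast_nonneg _
      linarith

end BoxSpace

/-! ### Positive semidefinite kernels on finite sets -/

section Kernels

open Matrix

/-! Coarse embeddability of a box space is equivalent to `HasUniformKernels`, a condition on kernels
whose scales are finite subsets of the group. It mentions neither the generating set nor the gaps,
so any choice of these can be made for `Γ`. One direction uses Gaussian kernels. In the other,
kernels ever closer to `1` at growing scales give feature maps whose Hilbert sum embeds each
quotient; the pieces are glued orthogonally along a line.

It remains to pass kernels from `H ⧸ N` to `Γ ⧸ K`, where `K = N ⋊ M` and `M` acts trivially on `H ⧸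
N`, so that `K` is normal. Let `F` be a Følner set in `G`, let `w x` be the image in `G ⧸ M` of the
uniform measure on `x.right • F`, and let `a x z` be the class of `z⁻¹ · x.left` in `H ⧸ N`, for a
fixed lift of `z`. The averaged kernel is `k x y = ∑ z, √(w x z) √(w y z) κ (a x z) (a y z)`. If `z
= x.right * f = y.right * f'` modulo `M`, then modulo `K` the difference of `a x z` and `a y z` is
`f⁻¹ (x⁻¹ y) f'` (`mk_inl_inv_mul_eq`). As `F` is finite, finite sets of differences in `H` and in
`Γ` correspond, and the Følner property makes the weights of nearby points overlap. `F` depends on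
the scale but not on `i`, so the estimates are uniform. -/

theorem Matrix.PosSemidef.map_pow {ι : Type*} [Finite ι] {A : Matrix ι ι ℝ} (hA : A.PosSemidef) (n : ℕ) :
    (A.map (· ^ n)).PosSemidef := by
  induction n with
  | zero =>
    have h : A.map (· ^ 0) = Matrix.gram ℝ fun _ : ι => (1 : ℝ) := by
      ext i j
      simp
    exact h ▸ Matrix.posSemidef_gram ℝ _
  | succ n ih =>
    have h : A.map (· ^ (n + 1)) = (A.map (· ^ n)) ⊙ A := by
      ext i j
      simp [pow_succ]
    exact h ▸ ih.hadamard hA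

/-- The entrywise exponential of a positive semidefinite real matrix is positive semidefinite. -/
theorem Matrix.PosSemidef.map_exp {ι : Type*} [Finite ι] {A : Matrix ι ι ℝ} (hA : A.PosSemidef) :
    (A.map Real.exp).PosSemidef := by
  refine ⟨?_, fun x => ?_⟩
  · ext i j
    have := hA.1.apply i j
    simp only [star_trivial] at this
    simp [this]
  -- The exponential series has nonnegative coefficients and entrywise powers are positive
  -- semidefinite, so the quadratic form is a sum of nonnegative terms.
  · have h : HasSum (fun n : ℕ => (n.factorial : ℝ)⁻¹ *
        x.sum fun i xi => x.sum fun j xj => star xi * (A.map (· ^ n)) i j * xj)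
        (x.sum fun i xi => x.sum fun j xj => star xi * (A.map Real.exp) i j * xj) := by
      simp only [Finsupp.sum, Finset.mul_sum]
      refine hasSum_sum fun i _ => hasSum_sum fun j _ => ?_
      have hexp : HasSum (fun n : ℕ => A i j ^ n / n.factorial) (Real.exp (A i j)) :=
        Real.exp_eq_exp_ℝ ▸ NormedSpace.expSeries_div_hasSum_exp (A i j)
      have := (hexp.mul_left (star (x i))).mul_right (x j)
      refine this.congr_fun ?_
      intro n
      simp only [Matrix.map_apply, div_eq_inv_mul]
      ring
    exact h.nonneg fun n => mul_nonneg (by positivity) ((hA.map_pow n).2 x)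

/-- The Gaussian kernel of a Hilbert space is positive semidefinite. -/
theorem Matrix.posSemidef_gaussian {ι E : Type*} [Finite ι] [NormedAddCommGroup E] [InnerProductSpace ℝ E]
    (F : ι → E) {t : ℝ} (ht : 0 ≤ t) :
    (Matrix.of fun x y => Real.exp (-t * ‖F x - F y‖ ^ 2)).PosSemidef := by
  -- Since `-t‖u - v‖² = 2t⟪u, v⟫ - t‖u‖² - t‖v‖²`, the kernel is the Schur product of the
  -- exponential of a Gram matrix and a rank-one matrix.
  have h1 := ((Matrix.posSemidef_gram ℝ F).smul (mul_nonneg zero_le_two ht)).map_exp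
  have h2 := Matrix.posSemidef_gram ℝ (fun x => Real.exp (-t * ‖F x‖ ^ 2))
  refine (congrArg Matrix.PosSemidef ?_).mp (h2.hadamard h1)
  ext x y
  simp only [Matrix.gram, Matrix.of_apply, Matrix.hadamard_apply, Matrix.map_apply,
    Matrix.smul_apply, smul_eq_mul]
  rw [norm_sub_sq_real, real_inner_comm, RCLike.inner_apply]
  simp only [conj_trivial, ← Real.exp_add]
  congr 1
  ring

/-- A positive semidefinite kernel on a finite set with ones on the diagonal comes from unit
vectors of a Euclidean space. -/
theorem Matrix.PosSemidef.exists_feature {ι : Type*} [Fintype ι] {k : Matrix ι ι ℝ}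
    (hk : k.PosSemidef) (h1 : ∀ x, k x x = 1) :
    ∃ ξ : ι → EuclideanSpace ℝ ι, (∀ x, ‖ξ x‖ = 1) ∧
      ∀ x y, ‖ξ x - ξ y‖ ^ 2 = 2 - 2 * k x y := by
  classical
  -- The columns of a factor `B` of `k = Bᴴ * B` serve as feature vectors.
  obtain ⟨B, rfl⟩ : ∃ B : Matrix ι ι ℝ, k = Bᴴ * B := by
    open scoped MatrixOrder in
    exact CStarAlgebra.nonneg_iff_eq_star_mul_self.mp hk.nonneg
  have hin : ∀ x y, inner ℝ (WithLp.toLp 2 (fun z => B z x)) (WithLp.toLp 2 (fun z => B z y)) =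
      (Bᴴ * B) x y := by
    intro x y
    simp [Matrix.mul_apply, PiLp.inner_apply, mul_comm]
  refine ⟨fun x => WithLp.toLp 2 (fun z => B z x), fun x => ?_, fun x y => ?_⟩
  · rw [norm_eq_sqrt_real_inner, hin, h1, Real.sqrt_one]
  rw [norm_sub_sq_real, ← real_inner_self_eq_norm_sq, ← real_inner_self_eq_norm_sq, hin, hin, hin,
    h1, h1]
  ring

end Kernels

/-! ### Word balls in the quotients versus finite subsets of the group -/

section WordMetric

variable {L : Type*} [Group L]

/-- Word balls of the quotients of `L` are images of finite subsets of `L`. -/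
theorem exists_finite_of_quotientCayley_dist_le {S : Set L} (hfin : S.Finite)
    (hS : Subgroup.closure S = ⊤) (R : ℕ) :
    ∃ A : Set L, A.Finite ∧ ∀ (K : FiniteIndexNormalSubgroup L) (x y : L ⧸ K.toSubgroup),
      (quotientCayley K S).dist x y ≤ R → x⁻¹ * y ∈ QuotientGroup.mk' K.toSubgroup '' A := by
  have key : ∀ R : ℕ, ∃ A : Set L, A.Finite ∧
      ∀ (K : FiniteIndexNormalSubgroup L) (x y : L ⧸ K.toSubgroup)
        (p : (quotientCayley K S).Walk x y), p.length ≤ R →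
        x⁻¹ * y ∈ QuotientGroup.mk' K.toSubgroup '' A := by
    intro R
    induction R with
    | zero =>
      refine ⟨{1}, Set.finite_singleton 1, fun K x y p hp => ?_⟩
      obtain rfl := SimpleGraph.Walk.eq_of_length_eq_zero (Nat.le_zero.1 hp)
      exact ⟨1, rfl, by simp⟩
    | succ R ih =>
      obtain ⟨A, hA, h⟩ := ih
      -- The element `1` accounts for the empty walk.
      refine ⟨{1} ∪ (S ∪ S⁻¹) * A, (Set.finite_singleton 1).union ((hfin.union hfin.inv).mul hA),
        fun K x y p hp => ?_⟩
      cases p with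
      | nil => exact ⟨1, Or.inl rfl, by simp⟩
      | @cons _ v _ hadj q =>
        rw [SimpleGraph.Walk.length_cons, Nat.succ_le_succ_iff] at hp
        obtain ⟨a, ha, hav⟩ := h K _ _ q hp
        rw [quotientCayley, SimpleGraph.mulCayley_adj'] at hadj
        obtain ⟨-, _, ⟨s, hs, rfl⟩, e⟩ := hadj
        rcases e with e | e
        · refine ⟨s * a, Or.inr (Set.mul_mem_mul (Or.inl hs) ha), ?_⟩
          rw [map_mul, hav, ← e]
          group
        · refine ⟨s⁻¹ * a, Or.inr (Set.mul_mem_mul (Or.inr (Set.inv_mem_inv.2 hs)) ha), ?_⟩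
          rw [map_mul, hav, e, map_inv]
          group
  obtain ⟨A, hA, h⟩ := key R
  refine ⟨A, hA, fun K x y hd => ?_⟩
  obtain ⟨p, hp⟩ := (quotientCayley_connected K hS).exists_walk_length_eq_dist x y
  exact h K x y p (hp ▸ hd)

/-- The images of a finite subset of `L` in the quotients of `L` have bounded word length. -/
theorem exists_quotientCayley_dist_le_of_finite {S : Set L} (hS : Subgroup.closure S = ⊤)
    {A : Set L} (hA : A.Finite) :
    ∃ R : ℕ, ∀ (K : FiniteIndexNormalSubgroup L) (x y : L ⧸ K.toSubgroup),
      x⁻¹ * y ∈ QuotientGroup.mk' K.toSubgroup '' A → (quotientCayley K S).dist x y ≤ R := by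
  have key : ∀ g : L, ∃ n : ℕ, ∀ (K : FiniteIndexNormalSubgroup L) (x : L ⧸ K.toSubgroup),
      (quotientCayley K S).dist x (x * QuotientGroup.mk' K.toSubgroup g) ≤ n := by
    intro g
    have hg : g ∈ Subgroup.closure S := by rw [hS]; trivial
    induction hg using Subgroup.closure_induction with
    | mem s hs =>
      refine ⟨1, fun K x => ?_⟩
      by_cases h : x = x * QuotientGroup.mk' K.toSubgroup s
      · rw [← h, SimpleGraph.dist_self]
        exact Nat.zero_le _
      · refine (SimpleGraph.dist_eq_one_iff_adj.2 ?_).le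
        rw [quotientCayley, SimpleGraph.mulCayley_adj']
        exact ⟨h, _, ⟨s, hs, rfl⟩, Or.inl rfl⟩
    | one => exact ⟨0, fun K x => by simp⟩
    | mul a b _ _ ha hb =>
      obtain ⟨m, hm⟩ := ha
      obtain ⟨n, hn⟩ := hb
      refine ⟨m + n, fun K x => ?_⟩
      refine ((quotientCayley_connected K hS).dist_triangle
        (v := x * QuotientGroup.mk' K.toSubgroup a)).trans (add_le_add (hm K x) ?_)
      rw [map_mul, ← mul_assoc]
      exact hn K _
    | inv a _ ha =>
      obtain ⟨m, hm⟩ := ha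
      refine ⟨m, fun K x => ?_⟩
      have := hm K (x * QuotientGroup.mk' K.toSubgroup a⁻¹)
      rwa [mul_assoc, ← map_mul, inv_mul_cancel, map_one, mul_one, SimpleGraph.dist_comm] at this
  choose n hn using key
  refine ⟨hA.toFinset.sup n, fun K x y => ?_⟩
  rintro ⟨a, ha, hxy⟩
  have := hn a K x
  rw [hxy, mul_inv_cancel_left] at this
  exact this.trans (Finset.le_sup (f := n) (hA.mem_toFinset.2 ha))

end WordMetric

/-- The quotients `L ⧸ K i` carry normalized positive semidefinite kernels that are close to `1` at
bounded scale and at most `1 / 2` far away from the diagonal, uniformly in `i`; scales are measured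
by finite subsets of `L`. -/
def HasUniformKernels {L : Type*} [Group L] (K : ℕ → FiniteIndexNormalSubgroup L) : Prop :=
  ∀ A : Set L, A.Finite → ∀ ε : ℝ, 0 < ε → ∃ B : Set L, B.Finite ∧
    ∀ i, ∃ k : Matrix (L ⧸ (K i).toSubgroup) (L ⧸ (K i).toSubgroup) ℝ,
      k.PosSemidef ∧ (∀ x, k x x = 1) ∧
      (∀ x y, x⁻¹ * y ∈ QuotientGroup.mk' (K i).toSubgroup '' A → 1 - ε ≤ k x y) ∧
      (∀ x y, x⁻¹ * y ∉ QuotientGroup.mk' (K i).toSubgroup '' B → k x y ≤ 1 / 2)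

/-- If a box space embeds coarsely into Hilbert space, then Gaussian kernels show that the
quotients have uniform kernels. -/
theorem HasUniformKernels.of_coarselyEmbedsIntoHilbert {L : Type*} [Group L]
    {K : ℕ → FiniteIndexNormalSubgroup L} {S : Set L} {gap : ℕ → ℝ} (hfin : S.Finite)
    {hS : Subgroup.closure S = ⊤} {hgap : IsBoxGap K S gap}
    (h : CoarselyEmbedsIntoHilbert (BoxSpace K S gap hS hgap)) : HasUniformKernels K := by
  obtain ⟨E, _, _, _, F, ρl, ρu, hl, hu, htl, -, hF⟩ := h
  have hF' : ∀ i (x y : L ⧸ (K i).toSubgroup),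
      ρl ((quotientCayley (K i) S).dist x y : ℝ≥0) ≤ ‖F ⟨i, x⟩ - F ⟨i, y⟩‖ ∧
      ‖F ⟨i, x⟩ - F ⟨i, y⟩‖ ≤ ρu ((quotientCayley (K i) S).dist x y : ℝ≥0) := by
    intro i x y
    have hd : nndist (α := BoxSpace K S gap hS hgap) ⟨i, x⟩ ⟨i, y⟩ =
        ((quotientCayley (K i) S).dist x y : ℝ≥0) := by
      apply NNReal.eq
      exact (boxDist_same K S gap i x y).trans (by simp)
    have := hF ⟨i, x⟩ ⟨i, y⟩
    rw [hd] at this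
    simpa only [← NNReal.coe_le_coe, coe_nndist, dist_eq_norm] using this
  intro A hA ε hε
  obtain ⟨R, hR⟩ := exists_quotientCayley_dist_le_of_finite hS hA
  set b : ℝ := ((ρu (R : ℝ≥0) : ℝ≥0) : ℝ)
  -- With this `t`, `exp (-t b²) ≥ 1 - t b² ≥ 1 - ε`; the added `1` keeps the denominator positive.
  set t : ℝ := ε / (b ^ 2 + 1) with ht
  have ht0 : 0 < t := by positivity
  have htb : t * b ^ 2 ≤ ε := by
    rw [ht, div_mul_eq_mul_div, div_le_iff₀ (by positivity)]
    nlinarith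
  -- Beyond distance `D` one has `t‖F x - F y‖² ≥ 1`, so the Gaussian is at most `1 / (1 + 1)`.
  obtain ⟨D, hD⟩ := ((htl.comp tendsto_natCast_atTop_atTop).eventually_ge_atTop
    (Real.toNNReal √(1 / t))).exists
  obtain ⟨B, hB, hBS⟩ := exists_finite_of_quotientCayley_dist_le hfin hS D
  refine ⟨B, hB, fun i => ⟨_, Matrix.posSemidef_gaussian (fun x => F ⟨i, x⟩) ht0.le, ?_, ?_, ?_⟩⟩
  · simp
  · intro x y hxy
    have h1 : ‖F ⟨i, x⟩ - F ⟨i, y⟩‖ ≤ b :=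
      (hF' i x y).2.trans (hu (by exact_mod_cast hR _ x y hxy))
    have h2 : t * ‖F ⟨i, x⟩ - F ⟨i, y⟩‖ ^ 2 ≤ ε :=
      (mul_le_mul_of_nonneg_left (pow_le_pow_left₀ (norm_nonneg _) h1 2) ht0.le).trans htb
    rw [Matrix.of_apply]
    linarith [Real.add_one_le_exp (-t * ‖F ⟨i, x⟩ - F ⟨i, y⟩‖ ^ 2)]
  · intro x y hxy
    have h1 : D ≤ (quotientCayley (K i) S).dist x y := by
      by_contra hlt
      exact hxy (hBS _ x y (not_le.1 hlt).le)
    have h2 : √(1 / t) ≤ ‖F ⟨i, x⟩ - F ⟨i, y⟩‖ :=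
      (Real.toNNReal_le_iff_le_coe.1 (hD.trans (hl (by exact_mod_cast h1)))).trans (hF' i x y).1
    have h3 : 1 ≤ t * ‖F ⟨i, x⟩ - F ⟨i, y⟩‖ ^ 2 := by
      have := pow_le_pow_left₀ (Real.sqrt_nonneg _) h2 2
      rw [Real.sq_sqrt (by positivity), div_le_iff₀ ht0] at this
      linarith
    rw [Matrix.of_apply, neg_mul, Real.exp_neg, one_div]
    refine inv_anti₀ two_pos ?_
    linarith [Real.add_one_le_exp (t * ‖F ⟨i, x⟩ - F ⟨i, y⟩‖ ^ 2)]

/-! ### Hilbert sums -/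

section DirectSums

theorem lp.norm_sq_single_sub_single {ι : Type*} [DecidableEq ι] {W : ι → Type*}
    [∀ i, NormedAddCommGroup (W i)] [∀ i, InnerProductSpace ℝ (W i)] {i j : ι} (h : i ≠ j)
    (a : W i) (b : W j) :
    ‖lp.single 2 i a - lp.single 2 j b‖ ^ 2 = ‖a‖ ^ 2 + ‖b‖ ^ 2 := by
  rw [norm_sub_sq_real, lp.inner_single_left, lp.norm_single two_pos, lp.norm_single two_pos,
    lp.coeFn_single, Pi.single_eq_of_ne h, inner_zero_right]
  ring

/-- The Hilbert sum of countably many maps whose differences are square summable. -/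
theorem exists_map_lp_hasSum_norm_sq {X V : Type*} [NormedAddCommGroup V] (ζ : ℕ → X → V) (e : X)
    (h : ∀ x, Summable fun n => ‖ζ n x - ζ n e‖ ^ 2) :
    ∃ F : X → lp (fun _ : ℕ => V) 2, F e = 0 ∧
      ∀ x y, HasSum (fun n => ‖ζ n x - ζ n y‖ ^ 2) (‖F x - F y‖ ^ 2) := by
  refine ⟨fun x => ⟨fun n => ζ n x - ζ n e, memℓp_gen ?_⟩, ?_, fun x y => ?_⟩
  · simpa using h x
  · ext n
    simp
  · have := lp.hasSum_norm (E := fun _ : ℕ => V) (p := 2) (by simp)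
      ((⟨fun n => ζ n x - ζ n e, memℓp_gen (by simpa using h x)⟩ : lp (fun _ : ℕ => V) 2) -
        ⟨fun n => ζ n y - ζ n e, memℓp_gen (by simpa using h y)⟩)
    simp only [ENNReal.toReal_ofNat, Real.rpow_ofNat] at this
    refine this.congr_fun fun n => ?_
    change _ = ‖(ζ n x - ζ n e) - (ζ n y - ζ n e)‖ ^ 2
    rw [sub_sub_sub_cancel_right]

end DirectSums

/-! ### From uniform kernels to coarse embeddings of box spaces -/

section BoxSpace

/-- A box space embeds coarsely into Hilbert space if its pieces do so uniformly. -/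
theorem BoxSpace.coarselyEmbedsIntoHilbert_of_pieces.{u} {L : Type u} [Group L]
    {K : ℕ → FiniteIndexNormalSubgroup L} {S : Set L} {gap : ℕ → ℝ}
    {hS : Subgroup.closure S = ⊤} {hgap : IsBoxGap K S gap} {W : ℕ → Type u}
    [∀ i, NormedAddCommGroup (W i)] [∀ i, InnerProductSpace ℝ (W i)] [∀ i, CompleteSpace (W i)]
    (F : ∀ i, L ⧸ (K i).toSubgroup → W i) (hF1 : ∀ i, F i 1 = 0)
    {ρl ρu : ℝ≥0 → ℝ≥0} (hl : Monotone ρl) (hu : Monotone ρu) (htl : Tendsto ρl atTop atTop)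
    (hlF : ∀ i x y, ρl ((quotientCayley (K i) S).dist x y : ℝ≥0) ≤ ‖F i x - F i y‖)
    (huF : ∀ i x y, ‖F i x - F i y‖ ≤ ρu ((quotientCayley (K i) S).dist x y : ℝ≥0)) :
    CoarselyEmbedsIntoHilbert (BoxSpace K S gap hS hgap) := by
  -- The real coordinate follows the thread of identity elements, and the pieces occupy mutually
  -- orthogonal summands.
  let Φ : (Σ i, L ⧸ (K i).toSubgroup) → WithLp 2 (ℝ × lp W 2) := fun p =>
    WithLp.toLp 2 (boxPos gap p.1, lp.single 2 p.1 (F p.1 p.2))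
  have hsame : ∀ i (x y : L ⧸ (K i).toSubgroup), ‖Φ ⟨i, x⟩ - Φ ⟨i, y⟩‖ = ‖F i x - F i y‖ := by
    intro i x y
    rw [← sq_eq_sq₀ (norm_nonneg _) (norm_nonneg _), WithLp.prod_norm_sq_eq_of_L2]
    simp only [Φ, WithLp.sub_fst, WithLp.sub_snd, WithLp.toLp_fst, WithLp.toLp_snd, sub_self]
    rw [← lp.single_sub, lp.norm_single two_pos]
    simp
  have hne : ∀ {i j} (_ : i ≠ j) (x : L ⧸ (K i).toSubgroup) (y : L ⧸ (K j).toSubgroup),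
      ‖Φ ⟨i, x⟩ - Φ ⟨j, y⟩‖ ^ 2 =
        |boxPos gap i - boxPos gap j| ^ 2 + (‖F i x‖ ^ 2 + ‖F j y‖ ^ 2) := by
    intro i j h x y
    rw [WithLp.prod_norm_sq_eq_of_L2]
    simp only [Φ, WithLp.sub_fst, WithLp.sub_snd, WithLp.toLp_fst, WithLp.toLp_snd]
    rw [lp.norm_sq_single_sub_single h, Real.norm_eq_abs]
  have h3 : Tendsto (fun t : ℝ≥0 => t / 3) atTop atTop :=
    tendsto_id.atTop_div_const (by norm_num)
  have hm3 : Monotone fun t : ℝ≥0 => t / 3 := fun a b hab => by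
    simp only
    gcongr
  -- Between different pieces the distance `D` is a sum of three terms, one of which is at least `D
  -- / 3`; each of the three orthogonal components bounds the norm from below. The upper bound adds
  -- the component along the thread, at most `D`, and two of size at most `ρu D`.
  refine ⟨WithLp 2 (ℝ × lp W 2), inferInstance, inferInstance, inferInstance, Φ,
    fun t => min (t / 3) (ρl (t / 3)), fun t => t + 2 * ρu t, hm3.min (hl.comp hm3), ?_, ?_, ?_, ?_⟩
  · intro a b hab
    have := hu hab
    simp only
    gcongr
  · exact tendsto_atTop.2 fun b => by
      filter_upwards [h3.eventually_ge_atTop b, (htl.comp h3).eventually_ge_atTop b] with t h1 h2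
      exact le_min h1 h2
  · exact tendsto_atTop_mono (fun t => le_self_add) tendsto_id
  · rintro ⟨i, x⟩ ⟨j, y⟩
    generalize hD : nndist (α := BoxSpace K S gap hS hgap) ⟨i, x⟩ ⟨j, y⟩ = D
    have hD' : boxDist K S gap ⟨i, x⟩ ⟨j, y⟩ = (D : ℝ) := congrArg NNReal.toReal hD
    rw [← NNReal.coe_le_coe, ← NNReal.coe_le_coe, coe_nndist, dist_eq_norm]
    have hD3 : D / 3 ≤ D := div_le_self (zero_le) (by norm_num)
    by_cases hij : i = j
    · subst hij
      rw [boxDist_same] at hD'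
      have hD'' : ((quotientCayley (K i) S).dist x y : ℝ≥0) = D := NNReal.eq (by simpa using hD')
      have h1 := hlF i x y
      have h2 := huF i x y
      rw [hD''] at h1 h2
      rw [hsame]
      constructor
      · refine le_trans ?_ h1
        exact NNReal.coe_le_coe.2 ((min_le_right _ _).trans (hl hD3))
      · push_cast
        linarith [D.coe_nonneg, (ρu D).coe_nonneg]
    · rw [boxDist_ne K S gap hij] at hD'
      have e := hne hij x y
      have hl1 := hlF i x 1
      have hu1 := huF i x 1
      have hl2 := hlF j 1 y
      have hu2 := huF j 1 y
      rw [hF1, sub_zero] at hl1 hu1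
      rw [hF1, zero_sub, norm_neg] at hl2 hu2
      generalize (quotientCayley (K i) S).dist x 1 = p at *
      generalize (quotientCayley (K j) S).dist 1 y = q at *
      have hb := abs_nonneg (boxPos gap i - boxPos gap j)
      generalize |boxPos gap i - boxPos gap j| = b at *
      have ha1 := norm_nonneg (F i x)
      generalize ‖F i x‖ = a₁ at *
      have ha2 := norm_nonneg (F j y)
      generalize ‖F j y‖ = a₂ at *
      have hn := norm_nonneg (Φ ⟨i, x⟩ - Φ ⟨j, y⟩)
      generalize ‖Φ ⟨i, x⟩ - Φ ⟨j, y⟩‖ = n at *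
      have hp0 : (0 : ℝ) ≤ p := p.cast_nonneg
      have hq0 : (0 : ℝ) ≤ q := q.cast_nonneg
      constructor
      · have hbn : b ≤ n := by
          refine le_of_sq_le_sq ?_ hn
          nlinarith
        have h1n : a₁ ≤ n := by
          refine le_of_sq_le_sq ?_ hn
          nlinarith
        have h2n : a₂ ≤ n := by
          refine le_of_sq_le_sq ?_ hn
          nlinarith
        by_cases hcb : (D : ℝ) / 3 ≤ b
        · refine le_trans (NNReal.coe_le_coe.2 (min_le_left _ _)) ?_
          push_cast
          exact hcb.trans hbn
        · refine le_trans (NNReal.coe_le_coe.2 (min_le_right _ _)) ?_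
          by_cases hcp : (D : ℝ) / 3 ≤ p
          · refine le_trans (NNReal.coe_le_coe.2 (hl ?_)) (hl1.trans h1n)
            exact_mod_cast hcp
          · refine le_trans (NNReal.coe_le_coe.2 (hl ?_)) (hl2.trans h2n)
            have : (D : ℝ) / 3 ≤ q := by
              push Not at hcb hcp
              linarith
            exact_mod_cast this
      · have h1 : ((ρu (p : ℝ≥0) : ℝ≥0) : ℝ) ≤ ρu D := by
          refine NNReal.coe_le_coe.2 (hu (NNReal.coe_le_coe.1 ?_))
          push_cast
          linarith
        have h2 : ((ρu (q : ℝ≥0) : ℝ≥0) : ℝ) ≤ ρu D := by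
          refine NNReal.coe_le_coe.2 (hu (NNReal.coe_le_coe.1 ?_))
          push_cast
          linarith
        have h4 : n ≤ b + a₁ + a₂ := by
          refine le_of_sq_le_sq ?_ (by positivity)
          nlinarith [mul_nonneg hb ha1, mul_nonneg hb ha2, mul_nonneg ha1 ha2]
        push_cast
        linarith

/-- If the quotients have uniform kernels, then every box space built from them embeds coarsely
into Hilbert space. -/
theorem HasUniformKernels.coarselyEmbedsIntoHilbert {L : Type*} [Group L]
    {K : ℕ → FiniteIndexNormalSubgroup L} (h : HasUniformKernels K) {S : Set L} {gap : ℕ → ℝ}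
    (hfin : S.Finite) (hS : Subgroup.closure S = ⊤) (hgap : IsBoxGap K S gap) :
    CoarselyEmbedsIntoHilbert (BoxSpace K S gap hS hgap) := by
  have : ∀ i, Fintype (L ⧸ (K i).toSubgroup) := fun i => Fintype.ofFinite _
  have feat : ∀ n : ℕ, ∃ D : ℕ, ∀ i,
      ∃ ξ : L ⧸ (K i).toSubgroup → EuclideanSpace ℝ (L ⧸ (K i).toSubgroup),
        (∀ x y, ‖ξ x - ξ y‖ ^ 2 ≤ 4) ∧
        (∀ x y, (quotientCayley (K i) S).dist x y ≤ n → ‖ξ x - ξ y‖ ^ 2 ≤ (1 / 2) ^ n) ∧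
        (∀ x y, D ≤ (quotientCayley (K i) S).dist x y → 1 ≤ ‖ξ x - ξ y‖ ^ 2) := by
    intro n
    obtain ⟨A, hA, hA'⟩ := exists_finite_of_quotientCayley_dist_le hfin hS n
    -- The exponent `n + 1` absorbs the factor `2` in `‖ξ x - ξ y‖² = 2 - 2 k x y`.
    obtain ⟨B, hB, hk⟩ := h A hA ((1 / 2) ^ (n + 1)) (by positivity)
    obtain ⟨D, hD⟩ := exists_quotientCayley_dist_le_of_finite hS hB
    refine ⟨D + 1, fun i => ?_⟩
    obtain ⟨k, hk, hk1, hkA, hkB⟩ := hk i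
    obtain ⟨ξ, hξ1, hξ⟩ := hk.exists_feature hk1
    refine ⟨ξ, fun x y => ?_, fun x y hxy => ?_, fun x y hxy => ?_⟩
    · have := norm_sub_le (ξ x) (ξ y)
      rw [hξ1, hξ1] at this
      nlinarith [norm_nonneg (ξ x - ξ y)]
    · rw [hξ]
      have := hkA x y (hA' _ x y hxy)
      rw [pow_succ] at this
      linarith
    · rw [hξ]
      have := hkB x y fun hmem => absurd (hD _ x y hmem) (by omega)
      linarith
  choose D ξ hξ4 hξn hξD using feat
  -- Majorant at distance `d`: the scales `n < d` contribute at most `4` each, the others at most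
  -- `2⁻ⁿ`.
  let c : ℕ → ℕ → ℝ := fun d n => (if n < d then 4 else 0) + (1 / 2) ^ n
  have hcsum : ∀ d, HasSum (c d) (d * 4 + 2) := by
    intro d
    refine HasSum.add ?_ hasSum_geometric_two
    have := hasSum_sum_of_ne_finset_zero (L := .unconditional ℕ) (f := fun n => if n < d then (4 : ℝ) else 0)
      (s := Finset.range d) (fun n hn => by simpa using hn)
    rwa [Finset.sum_congr rfl (g := fun _ => (4 : ℝ)) fun n hn => if_pos (Finset.mem_range.1 hn),
      Finset.sum_const, Finset.card_range, nsmul_eq_mul] at this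
  have hξc : ∀ i x y n, ‖ξ n i x - ξ n i y‖ ^ 2 ≤ c ((quotientCayley (K i) S).dist x y) n := by
    intro i x y n
    simp only [c]
    split_ifs with hn
    · linarith [hξ4 n i x y, show (0 : ℝ) ≤ (1 / 2) ^ n by positivity]
    · linarith [hξn n i x y (not_lt.1 hn)]
  have hlp := fun i => exists_map_lp_hasSum_norm_sq (fun n => ξ n i) 1 fun x =>
    Summable.of_nonneg_of_le (fun n => sq_nonneg _) (hξc i x 1) (hcsum _).summable
  choose F hF1 hF using hlp
  -- Each counted scale contributes at least `1` to the squared norm at distance `d`. The cutoff `n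
  -- < d` keeps the count finite.
  let m : ℕ → ℕ := fun d => ((Finset.range d).filter fun n => D n ≤ d).card
  have hm : Monotone m := fun a b hab => Finset.card_le_card fun n hn => by
    simp only [Finset.mem_filter, Finset.mem_range] at hn ⊢
    omega
  have hmt : Tendsto m atTop atTop := by
    refine tendsto_atTop_atTop_of_monotone hm fun b => ?_
    refine ⟨max b ((Finset.range b).sup D), ?_⟩
    conv_lhs => rw [← Finset.card_range b]
    refine Finset.card_le_card fun n hn => ?_
    have h1 := Finset.le_sup (f := D) hn
    simp only [Finset.mem_filter, Finset.mem_range] at hn ⊢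
    omega
  -- The squared norm lies between `m d` and `4d + 2 ≤ (2d + 2)²`.
  refine BoxSpace.coarselyEmbedsIntoHilbert_of_pieces F hF1
    (ρl := fun t => NNReal.sqrt (m ⌊t⌋₊)) (ρu := fun t => 2 * t + 2) ?_ ?_ ?_ ?_ ?_
  · intro a b hab
    exact NNReal.sqrt.monotone (by exact_mod_cast hm (Nat.floor_mono hab))
  · intro a b hab
    simp only
    gcongr
  · exact (NNReal.sqrt.tendsto_atTop.comp tendsto_natCast_atTop_atTop).comp
      (hmt.comp tendsto_nat_floor_atTop)
  · intro i x y
    simp only [Nat.floor_natCast, Real.coe_sqrt, NNReal.coe_natCast]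
    refine Real.sqrt_le_iff.2 ⟨norm_nonneg _, ?_⟩
    refine le_trans ?_ (sum_le_hasSum ((Finset.range ((quotientCayley (K i) S).dist x y)).filter fun n =>
      D n ≤ (quotientCayley (K i) S).dist x y) (fun n _ => sq_nonneg _) (hF i x y))
    refine le_trans (by simp [m]) (Finset.card_nsmul_le_sum _ _ 1 fun n hn => ?_)
    exact hξD n i x y (Finset.mem_filter.1 hn).2
  · intro i x y
    refine le_of_sq_le_sq ?_ (by positivity)
    refine (hasSum_le (hξc i x y) (hF i x y) (hcsum _)).trans ?_
    push_cast
    nlinarith [Nat.cast_nonneg (α := ℝ) ((quotientCayley (K i) S).dist x y)]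

end BoxSpace

/-! ### Finite-index subgroups of the factors and of the semidirect product -/

section Subgroups

theorem Group.countable_of_fg (G : Type*) [Group G] [Group.FG G] : Countable G := by
  obtain ⟨S, hS, hfin⟩ := Group.fg_iff.1 ‹Group.FG G›
  have := hfin.to_subtype
  have : Countable (FreeGroup S) := inferInstance
  have hsurj : Function.Surjective (FreeGroup.lift (Subtype.val : S → G)) := by
    rw [← MonoidHom.range_eq_top, FreeGroup.range_lift_eq_closure, Subtype.range_coe, hS]
  exact hsurj.countable

/-- A countable residually finite group has a nested sequence of finite-index normal subgroups with
trivial intersection. -/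
theorem Group.ResiduallyFinite.exists_antitone_iInf_eq_bot (G : Type*) [Group G] [Countable G]
    [Group.ResiduallyFinite G] :
    ∃ M : ℕ → FiniteIndexNormalSubgroup G, Antitone M ∧ ⨅ i, (M i).toSubgroup = ⊥ := by
  obtain ⟨e, he⟩ := exists_surjective_nat G
  have hU : ∀ n, ∃ U : FiniteIndexNormalSubgroup G, e n ∈ U → e n = 1 := by
    intro n
    by_cases h : e n = 1
    · exact ⟨⟨⊤, inferInstance, inferInstance⟩, fun _ => h⟩
    · obtain ⟨U, hU⟩ := Group.exists_finiteIndexNormalSubgroup_notMem (e n) h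
      exact ⟨U, fun h' => absurd h' hU⟩
  choose U hU using hU
  let M : ℕ → FiniteIndexNormalSubgroup G := fun n => Nat.rec (U 0) (fun k V => V ⊓ U (k + 1)) n
  have hMU : ∀ n, M n ≤ U n := by
    intro n
    cases n with
    | zero => exact le_refl _
    | succ n => exact inf_le_right
  refine ⟨M, antitone_nat_of_succ_le fun n => inf_le_left, ?_⟩
  rw [eq_bot_iff]
  intro g hg
  obtain ⟨n, rfl⟩ := he g
  exact Subgroup.mem_bot.2 (hU n (hMU n (Subgroup.mem_iInf.1 hg n)))

/-- The subgroup of those elements that act trivially on the quotient by a characteristic subgroup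
of finite index has finite index. -/
theorem exists_finiteIndexNormalSubgroup_act_trivially {H G : Type*} [Group H] [Group G]
    (φ : G →* MulAut H) (N : FiniteIndexNormalSubgroup H) (hN : N.toSubgroup.Characteristic) :
    ∃ P : FiniteIndexNormalSubgroup G,
      ∀ g, g ∈ P.toSubgroup ↔ ∀ h, h⁻¹ * φ g h ∈ N.toSubgroup := by
  let ψ : G →* MulAut (H ⧸ N.toSubgroup) :=
    { toFun := fun g => QuotientGroup.congr N.toSubgroup N.toSubgroup (φ g)
        (Subgroup.characteristic_iff_map_eq.1 hN (φ g))
      map_one' := by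
        ext q
        obtain ⟨h, rfl⟩ := QuotientGroup.mk_surjective q
        simp
      map_mul' := fun a b => by
        ext q
        obtain ⟨h, rfl⟩ := QuotientGroup.mk_surjective q
        simp only [map_mul, QuotientGroup.congr_mk, MulAut.mul_apply]
        rfl }
  have : Finite (MulAut (H ⧸ N.toSubgroup)) :=
    Finite.of_injective (fun f : MulAut (H ⧸ N.toSubgroup) => (f : H ⧸ N.toSubgroup → _))
      DFunLike.coe_injective
  refine ⟨⟨ψ.ker, inferInstance, inferInstance⟩, fun g => ?_⟩
  rw [MonoidHom.mem_ker, MulEquiv.ext_iff]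
  constructor
  · intro h x
    exact QuotientGroup.eq.1 (h (x : H ⧸ N.toSubgroup)).symm
  · intro h q
    obtain ⟨x, rfl⟩ := QuotientGroup.mk_surjective q
    exact (QuotientGroup.eq.2 (h x)).symm

/-- If `N` is characteristic and `M` acts trivially on `H ⧸ N`, then `N ⋊ M` is a normal subgroup
of finite index of the semidirect product. -/
theorem exists_finiteIndexNormalSubgroup_semidirectProduct {H G : Type*} [Group H] [Group G]
    (φ : G →* MulAut H) (N : FiniteIndexNormalSubgroup H) (hN : N.toSubgroup.Characteristic)
    (M : FiniteIndexNormalSubgroup G)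
    (hM : ∀ g ∈ M.toSubgroup, ∀ h, h⁻¹ * φ g h ∈ N.toSubgroup) :
    ∃ K : FiniteIndexNormalSubgroup (H ⋊[φ] G),
      ∀ x, x ∈ K.toSubgroup ↔ x.left ∈ N.toSubgroup ∧ x.right ∈ M.toSubgroup := by
  have hφ : ∀ (g : G) {n : H}, n ∈ N.toSubgroup → φ g n ∈ N.toSubgroup := fun g n hn =>
    Subgroup.characteristic_iff_le_comap.1 hN (φ g) hn
  let K : Subgroup (H ⋊[φ] G) :=
    { carrier := {x | x.left ∈ N.toSubgroup ∧ x.right ∈ M.toSubgroup}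
      one_mem' := ⟨N.toSubgroup.one_mem, M.toSubgroup.one_mem⟩
      mul_mem' := fun {a b} ha hb =>
        ⟨N.toSubgroup.mul_mem ha.1 (hφ _ hb.1), M.toSubgroup.mul_mem ha.2 hb.2⟩
      inv_mem' := fun {a} ha =>
        ⟨hφ _ (N.toSubgroup.inv_mem ha.1), M.toSubgroup.inv_mem ha.2⟩ }
  have hK : ∀ x, x ∈ K ↔ x.left ∈ N.toSubgroup ∧ x.right ∈ M.toSubgroup := fun x => Iff.rfl
  have hnormal : K.Normal := by
    refine ⟨fun k hk x => ⟨?_, M.isNormal'.conj_mem _ hk.2 _⟩⟩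
    -- For `x = (h, g)` and `k = (n, m)`, the `H`-component of `x k x⁻¹` is `(h · φ g n · h⁻¹) · (h
    -- · φ (g m g⁻¹) h⁻¹)`. The second factor lies in `N` because `g m g⁻¹` acts trivially modulo
    -- `N`.
    have h1 := N.isNormal'.conj_mem _ (hφ x.right hk.1) x.left
    have h2 := hM _ (M.isNormal'.conj_mem _ hk.2 x.right) x.left⁻¹
    have h3 := N.toSubgroup.mul_mem h1 h2
    convert h3 using 1
    simp [mul_assoc]
  have hfinite : Finite ((H ⋊[φ] G) ⧸ K) := by
    refine Finite.of_injective (fun q : (H ⋊[φ] G) ⧸ K =>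
      ((q.out.left : H ⧸ N.toSubgroup), (q.out.right : G ⧸ M.toSubgroup))) fun p q hpq => ?_
    obtain ⟨h1, h2⟩ := Prod.ext_iff.1 hpq
    rw [← QuotientGroup.out_eq' p, ← QuotientGroup.out_eq' q]
    refine QuotientGroup.eq.2 ((hK _).2 ⟨?_, QuotientGroup.eq.1 h2⟩)
    have := hφ p.out.right⁻¹ (QuotientGroup.eq.1 h1)
    simpa using this
  exact ⟨⟨K, hnormal, Subgroup.finiteIndex_of_finite_quotient⟩, hK⟩

end Subgroups

/-! ### Følner sets and their images in finite quotients -/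

section Folner

open Finset

theorem Finset.abs_card_sub_card_le_card_symmDiff {α : Type*} [DecidableEq α] (s t : Finset α) :
    |(#s : ℝ) - #t| ≤ #(s ∆ t) := by
  have h1 : (#s : ℝ) ≤ #t + #(s ∆ t) := by
    exact_mod_cast (card_le_card fun x hx => by
      simp only [mem_union, mem_symmDiff]; tauto).trans (card_union_le t (s ∆ t))
  have h2 : (#t : ℝ) ≤ #s + #(s ∆ t) := by
    exact_mod_cast (card_le_card fun x hx => by
      simp only [mem_union, mem_symmDiff]; tauto).trans (card_union_le s (s ∆ t))
  rw [abs_le]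
  constructor <;> linarith

variable {G : Type*} [Group G]

/-- The image in `G ⧸ M` of the uniform probability measure on `F`. -/
noncomputable def cosetWeight (M : Subgroup G) [DecidableEq (G ⧸ M)] (F : Finset G) (z : G ⧸ M) :
    ℝ :=
  #{f ∈ F | QuotientGroup.mk (s := M) f = z} / #F

variable (M : Subgroup G) [DecidableEq (G ⧸ M)] (F : Finset G)

theorem cosetWeight_nonneg (z : G ⧸ M) : 0 ≤ cosetWeight M F z := by
  unfold cosetWeight
  positivity

theorem exists_mem_of_cosetWeight_ne_zero {z : G ⧸ M} (h : cosetWeight M F z ≠ 0) :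
    ∃ f ∈ F, (f : G ⧸ M) = z := by
  contrapose! h
  rw [cosetWeight, filter_eq_empty_iff.2 fun f hf => h f hf]
  simp

theorem sum_cosetWeight [M.Normal] [Fintype (G ⧸ M)] (hF : F.Nonempty) (q : G ⧸ M) :
    ∑ z, cosetWeight M F (q * z) = 1 := by
  refine (Equiv.sum_comp (Equiv.mulLeft q) (cosetWeight M F)).trans ?_
  have hcard : (#F : ℝ) ≠ 0 := by exact_mod_cast hF.card_pos.ne'
  simp only [cosetWeight, ← sum_div]
  rw [div_eq_one_iff_eq hcard]
  exact_mod_cast (card_eq_sum_card_fiberwise (f := fun f : G => (f : G ⧸ M)) (s := F)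
    (t := univ) fun _ _ => by simp).symm

/-- Translating the image measure by `s` gives the image of the measure on `s • F`, and passing to
the quotient does not increase the `ℓ¹` distance. Hence the bound is independent of `M`, even when
`F` does not inject into `G ⧸ M`. -/
theorem sum_abs_cosetWeight_sub_le [DecidableEq G] [M.Normal] [Fintype (G ⧸ M)] (s : G) (p q : G ⧸ M)
    (hpq : p⁻¹ * q = (s : G ⧸ M)) :
    ∑ z, |cosetWeight M F (p⁻¹ * z) - cosetWeight M F (q⁻¹ * z)| ≤ #((s • F) ∆ F) / #F := by
  obtain rfl : q = p * s := by rw [← hpq, mul_inv_cancel_left]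
  rw [← Equiv.sum_comp (Equiv.mulLeft p)]
  simp only [Equiv.coe_mulLeft, inv_mul_cancel_left, mul_inv_rev, mul_assoc]
  have hshift : ∀ z : G ⧸ M, #{f ∈ F | QuotientGroup.mk (s := M) f = (s : G ⧸ M)⁻¹ * z} =
      #{f ∈ s • F | QuotientGroup.mk (s := M) f = z} := by
    intro z
    refine card_bij (fun f _ => s * f) ?_ (fun _ _ _ _ h => mul_left_cancel h) ?_
    · intro f hf
      rw [mem_filter] at hf ⊢
      exact ⟨smul_mem_smul_finset hf.1, by rw [QuotientGroup.mk_mul, hf.2, mul_inv_cancel_left]⟩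
    · intro f hf
      rw [mem_filter, mem_smul_finset] at hf
      obtain ⟨⟨a, ha, rfl⟩, h⟩ := hf
      refine ⟨a, mem_filter.2 ⟨ha, ?_⟩, rfl⟩
      rw [← h, smul_eq_mul, QuotientGroup.mk_mul, inv_mul_cancel_left]
  have hterm : ∀ z : G ⧸ M, |cosetWeight M F z - cosetWeight M F ((s : G ⧸ M)⁻¹ * z)| ≤
      #{f ∈ (s • F) ∆ F | QuotientGroup.mk (s := M) f = z} / #F := by
    intro z
    rw [cosetWeight, cosetWeight, hshift, ← sub_div, abs_div, Nat.abs_cast, abs_sub_comm]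
    gcongr
    refine (Finset.abs_card_sub_card_le_card_symmDiff _ _).trans ?_
    gcongr
    intro f hf
    simp only [mem_symmDiff, mem_filter] at hf ⊢
    tauto
  refine (sum_le_sum fun z _ => hterm z).trans_eq ?_
  rw [← sum_div]
  congr 1
  exact_mod_cast (card_eq_sum_card_fiberwise (f := fun f : G => (f : G ⧸ M)) (s := (s • F) ∆ F)
    (t := univ) fun _ _ => by simp).symm

end Folner

/-! ### Averaging kernels over a Følner set -/

section SemidirectProduct

open SemidirectProduct Finset

variable {H G : Type*} [Group H] [Group G] {φ : G →* MulAut H}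
  {N : FiniteIndexNormalSubgroup H} {M : FiniteIndexNormalSubgroup G}
  {K : FiniteIndexNormalSubgroup (H ⋊[φ] G)}

/-- The representative in `H ⧸ N` of the `H`-component of `x`, conjugated by `z : G ⧸ M`. -/
noncomputable def fiberPoint (N : FiniteIndexNormalSubgroup H) (M : FiniteIndexNormalSubgroup G)
    (x : H ⋊[φ] G) (z : G ⧸ M.toSubgroup) : H ⧸ N.toSubgroup :=
  QuotientGroup.mk' N.toSubgroup (φ z.out⁻¹ x.left)

/-- Moving `inr z.out` to the right turns the second product into `inl x.left * inr z.out`, and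
`z.out` agrees with `x.right * f` modulo `M`. -/
theorem mk_mul_inr_eq (hK : ∀ x, x ∈ K.toSubgroup ↔ x.left ∈ N.toSubgroup ∧ x.right ∈ M.toSubgroup)
    (x : H ⋊[φ] G) (f : G) (z : G ⧸ M.toSubgroup) (hz : ((x.right * f : G) : G ⧸ M.toSubgroup) = z) :
    QuotientGroup.mk' K.toSubgroup (x * inr f) =
      QuotientGroup.mk' K.toSubgroup (inr z.out * inl (φ z.out⁻¹ x.left)) := by
  refine (QuotientGroup.eq.2 ((hK _).2 ⟨?_, ?_⟩)).symm
  · simp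
  · have : (z.out : G ⧸ M.toSubgroup) = ((x.right * f : G) : G ⧸ M.toSubgroup) := by
      rw [hz, QuotientGroup.out_eq']
    simpa [mul_assoc] using QuotientGroup.eq.1 this

/-- Dividing the two factorizations over the same `z` cancels `inr z.out`. This converts differences
in `H` into differences in the semidirect product, and is used for both kernel estimates. -/
theorem mk_inl_inv_mul_eq
    (hK : ∀ x, x ∈ K.toSubgroup ↔ x.left ∈ N.toSubgroup ∧ x.right ∈ M.toSubgroup)
    (x y : H ⋊[φ] G) (f f' : G) (z : G ⧸ M.toSubgroup)
    (hx : ((x.right * f : G) : G ⧸ M.toSubgroup) = z)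
    (hy : ((y.right * f' : G) : G ⧸ M.toSubgroup) = z) :
    QuotientGroup.mk' K.toSubgroup (inl ((φ z.out⁻¹ x.left)⁻¹ * φ z.out⁻¹ y.left)) =
      QuotientGroup.mk' K.toSubgroup ((inr f)⁻¹ * (x⁻¹ * y) * inr f') := by
  have h1 := mk_mul_inr_eq hK x f z hx
  have h2 := mk_mul_inr_eq hK y f' z hy
  have : (inr f : H ⋊[φ] G)⁻¹ * (x⁻¹ * y) * inr f' = (x * inr f)⁻¹ * (y * inr f') := by group
  rw [this, map_mul _ (x * inr f)⁻¹, map_inv _ (x * inr f), h1, h2]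
  generalize φ z.out⁻¹ x.left = a
  generalize φ z.out⁻¹ y.left = b
  simp only [map_mul, map_inv]
  group

theorem fiberPoint_inv_mul (x y : H ⋊[φ] G) (z : G ⧸ M.toSubgroup) :
    (fiberPoint N M x z)⁻¹ * fiberPoint N M y z =
      QuotientGroup.mk' N.toSubgroup ((φ z.out⁻¹ x.left)⁻¹ * φ z.out⁻¹ y.left) := by
  rfl

theorem mk_eq_mk_left_of_mk_inl_eq
    (hK : ∀ x, x ∈ K.toSubgroup ↔ x.left ∈ N.toSubgroup ∧ x.right ∈ M.toSubgroup) {c : H}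
    {t : H ⋊[φ] G} (h : QuotientGroup.mk' K.toSubgroup (inl c) = QuotientGroup.mk' K.toSubgroup t) :
    QuotientGroup.mk' N.toSubgroup c = QuotientGroup.mk' N.toSubgroup t.left := by
  have := ((hK _).1 (QuotientGroup.eq.1 h)).1
  refine QuotientGroup.eq.2 ?_
  simpa using this

theorem mk_inl_eq_of_mk_eq
    (hK : ∀ x, x ∈ K.toSubgroup ↔ x.left ∈ N.toSubgroup ∧ x.right ∈ M.toSubgroup) {c d : H}
    (h : QuotientGroup.mk' N.toSubgroup c = QuotientGroup.mk' N.toSubgroup d) :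
    QuotientGroup.mk' K.toSubgroup (inl c) = QuotientGroup.mk' K.toSubgroup (inl d) := by
  refine QuotientGroup.eq.2 ((hK _).2 ⟨?_, ?_⟩)
  · simpa using QuotientGroup.eq.1 h
  · simp

theorem mk_right_of_mk_eq
    (hK : ∀ x, x ∈ K.toSubgroup ↔ x.left ∈ N.toSubgroup ∧ x.right ∈ M.toSubgroup)
    {s t : H ⋊[φ] G} (h : QuotientGroup.mk' K.toSubgroup s = QuotientGroup.mk' K.toSubgroup t) :
    (s.right : G ⧸ M.toSubgroup) = t.right :=
  QuotientGroup.eq.2 (by simpa using ((hK _).1 (QuotientGroup.eq.1 h)).2)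

/-- Rests on `√u √v = (u + v) / 2 - (√u - √v)² / 2` and `(√u - √v)² ≤ |u - v|`. -/
theorem one_sub_sum_le {ι : Type*} (s : Finset ι) (u v κ : ι → ℝ) {δ δ' : ℝ} (hδ' : 0 ≤ δ')
    (hu : ∀ z, 0 ≤ u z) (hv : ∀ z, 0 ≤ v z) (hu1 : ∑ z ∈ s, u z = 1) (hv1 : ∑ z ∈ s, v z = 1)
    (huv : ∑ z ∈ s, |u z - v z| ≤ δ) (hκ : ∀ z, u z ≠ 0 → v z ≠ 0 → 1 - δ' ≤ κ z) :
    1 - (δ / 2 + δ') ≤ ∑ z ∈ s, √(u z) * √(v z) * κ z := by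
  have key : ∀ z, (u z + v z) / 2 - (|u z - v z| / 2 + (u z + v z) / 2 * δ') ≤
      √(u z) * √(v z) * κ z := by
    intro z
    have ha := Real.sqrt_nonneg (u z)
    have hb := Real.sqrt_nonneg (v z)
    have hk : √(u z) * √(v z) * (1 - δ') ≤ √(u z) * √(v z) * κ z := by
      by_cases h1 : u z = 0
      · simp [h1]
      by_cases h2 : v z = 0
      · simp [h2]
      exact mul_le_mul_of_nonneg_left (hκ z h1 h2) (mul_nonneg ha hb)
    refine le_trans ?_ hk
    have hua := Real.sq_sqrt (hu z)
    have hvb := Real.sq_sqrt (hv z)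
    generalize √(u z) = a at *
    generalize √(v z) = b at *
    rw [← hua, ← hvb]
    have habs : (a - b) ^ 2 ≤ |a ^ 2 - b ^ 2| := by
      rw [sq_sub_sq, abs_mul, abs_of_nonneg (add_nonneg ha hb), ← sq_abs, sq]
      refine mul_le_mul_of_nonneg_right ?_ (abs_nonneg _)
      rw [abs_le]
      constructor <;> linarith
    nlinarith [mul_nonneg hδ' (sq_nonneg (a - b))]
  refine le_trans ?_ (sum_le_sum fun z _ => key z)
  rw [sum_sub_distrib, sum_add_distrib, ← sum_mul, ← sum_div, ← sum_div, sum_add_distrib, hu1, hv1]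
  linarith

/-- By the inequality of arithmetic and geometric means, the products `√u √v` sum to at most `1`;
this is why `c` must be nonnegative. -/
theorem sum_sqrt_mul_sqrt_mul_le {ι : Type*} (s : Finset ι) (u v κ : ι → ℝ) {c : ℝ} (hc : 0 ≤ c)
    (hu : ∀ z, 0 ≤ u z) (hv : ∀ z, 0 ≤ v z) (hu1 : ∑ z ∈ s, u z = 1) (hv1 : ∑ z ∈ s, v z = 1)
    (hκ : ∀ z, u z ≠ 0 → v z ≠ 0 → κ z ≤ c) :
    ∑ z ∈ s, √(u z) * √(v z) * κ z ≤ c := by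
  have key : ∀ z, √(u z) * √(v z) * κ z ≤ (u z + v z) / 2 * c := by
    intro z
    have ha := Real.sqrt_nonneg (u z)
    have hb := Real.sqrt_nonneg (v z)
    have hk : √(u z) * √(v z) * κ z ≤ √(u z) * √(v z) * c := by
      by_cases h1 : u z = 0
      · simp [h1]
      by_cases h2 : v z = 0
      · simp [h2]
      exact mul_le_mul_of_nonneg_left (hκ z h1 h2) (mul_nonneg ha hb)
    refine hk.trans (mul_le_mul_of_nonneg_right ?_ hc)
    nlinarith [Real.sq_sqrt (hu z), Real.sq_sqrt (hv z), sq_nonneg (√(u z) - √(v z))]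
  refine (sum_le_sum fun z _ => key z).trans ?_
  rw [← sum_mul, ← sum_div, sum_add_distrib, hu1, hv1]
  linarith

/-- The kernel on the quotient of a semidirect product obtained by averaging a kernel on `H ⧸ N`
over translates of the Følner set `F`. -/
theorem exists_kernel_semidirectProduct [DecidableEq G]
    (hK : ∀ x, x ∈ K.toSubgroup ↔ x.left ∈ N.toSubgroup ∧ x.right ∈ M.toSubgroup)
    {F : Finset G} (hF : F.Nonempty) {A : Set (H ⋊[φ] G)} {B : Set H} {δ δ' : ℝ} (hδ' : 0 ≤ δ')
    (hFA : ∀ s ∈ A, (#((s.right • F) ∆ F) : ℝ) ≤ δ * #F)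
    {κ : Matrix (H ⧸ N.toSubgroup) (H ⧸ N.toSubgroup) ℝ} (hκ : κ.PosSemidef)
    (hκ1 : ∀ u, κ u u = 1)
    (hκA : ∀ u v, (∃ f ∈ F, ∃ s ∈ A, ∃ f' ∈ F, u⁻¹ * v =
      QuotientGroup.mk' N.toSubgroup ((inr f)⁻¹ * s * inr f').left) → 1 - δ' ≤ κ u v)
    (hκB : ∀ u v, u⁻¹ * v ∉ QuotientGroup.mk' N.toSubgroup '' B → κ u v ≤ 1 / 2) :
    ∃ k : Matrix ((H ⋊[φ] G) ⧸ K.toSubgroup) ((H ⋊[φ] G) ⧸ K.toSubgroup) ℝ,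
      k.PosSemidef ∧ (∀ x, k x x = 1) ∧
      (∀ x y, x⁻¹ * y ∈ QuotientGroup.mk' K.toSubgroup '' A → 1 - (δ / 2 + δ') ≤ k x y) ∧
      (∀ x y, (∀ f ∈ F, ∀ c ∈ B, ∀ f' ∈ F,
        x⁻¹ * y ≠ QuotientGroup.mk' K.toSubgroup (inr f * inl c * (inr f')⁻¹)) →
        k x y ≤ 1 / 2) := by
  classical
  have : Fintype (G ⧸ M.toSubgroup) := Fintype.ofFinite _
  let w : (H ⋊[φ] G) ⧸ K.toSubgroup → G ⧸ M.toSubgroup → ℝ := fun x z =>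
    cosetWeight M.toSubgroup F ((x.out.right : G ⧸ M.toSubgroup)⁻¹ * z)
  let a : (H ⋊[φ] G) ⧸ K.toSubgroup → G ⧸ M.toSubgroup → H ⧸ N.toSubgroup := fun x z =>
    fiberPoint N M x.out z
  have hw : ∀ x z, 0 ≤ w x z := fun x z => cosetWeight_nonneg _ _ _
  have hw1 : ∀ x, ∑ z, w x z = 1 := fun x => sum_cosetWeight _ _ hF _
  have hmem : ∀ x z, w x z ≠ 0 → ∃ f ∈ F, ((x.out.right * f : G) : G ⧸ M.toSubgroup) = z := by
    intro x z h
    obtain ⟨f, hf, hfz⟩ := exists_mem_of_cosetWeight_ne_zero _ _ h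
    exact ⟨f, hf, by rw [QuotientGroup.mk_mul, hfz, mul_inv_cancel_left]⟩
  have hxy : ∀ x y : (H ⋊[φ] G) ⧸ K.toSubgroup,
      QuotientGroup.mk' K.toSubgroup (x.out⁻¹ * y.out) = x⁻¹ * y := by
    intro x y
    rw [map_mul, map_inv]
    congr 2 <;> exact QuotientGroup.out_eq' _
  let k : Matrix ((H ⋊[φ] G) ⧸ K.toSubgroup) ((H ⋊[φ] G) ⧸ K.toSubgroup) ℝ :=
    Matrix.of fun x y => ∑ z, √(w x z) * √(w y z) * κ (a x z) (a y z)
  refine ⟨k, ?_, ?_, ?_, ?_⟩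
  -- For each `z` the summand is the Schur product of a rank-one matrix and a pullback of `κ`.
  · have hsum : k = ∑ z, (Matrix.gram ℝ fun x => √(w x z)).hadamard
        (κ.submatrix (a · z) (a · z)) := by
      ext x y
      rw [Matrix.sum_apply]
      simp only [k, Matrix.of_apply, Matrix.hadamard_apply, Matrix.gram_apply,
        Matrix.submatrix_apply, RCLike.inner_apply, conj_trivial]
      exact sum_congr rfl fun z _ => by ring
    rw [hsum]
    exact Matrix.posSemidef_sum _ fun z _ =>
      (Matrix.posSemidef_gram ℝ _).hadamard (hκ.submatrix _)
  · intro x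
    simp only [k, Matrix.of_apply, hκ1, mul_one]
    rw [← hw1 x]
    exact sum_congr rfl fun z _ => Real.mul_self_sqrt (hw x z)
  · rintro x y ⟨s, hs, hsxy⟩
    refine one_sub_sum_le univ (w x) (w y) _ hδ' (hw x) (hw y) (hw1 x) (hw1 y) ?_ ?_
    · refine (sum_abs_cosetWeight_sub_le M.toSubgroup F s.right _ _ ?_).trans ?_
      · have := mk_right_of_mk_eq hK ((hxy x y).trans hsxy.symm)
        simpa using this
      · rw [div_le_iff₀ (by exact_mod_cast hF.card_pos)]
        exact hFA s hs
    · intro z hx hy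
      obtain ⟨f, hf, hfz⟩ := hmem x z hx
      obtain ⟨f', hf', hfz'⟩ := hmem y z hy
      refine hκA _ _ ⟨f, hf, s, hs, f', hf', ?_⟩
      rw [fiberPoint_inv_mul]
      refine mk_eq_mk_left_of_mk_inl_eq hK ?_
      rw [mk_inl_inv_mul_eq hK _ _ f f' z hfz hfz', map_mul, map_mul, hxy, ← hsxy, map_mul, map_mul]
  · intro x y h
    refine sum_sqrt_mul_sqrt_mul_le univ (w x) (w y) _ (by norm_num) (hw x) (hw y) (hw1 x) (hw1 y) ?_
    intro z hx hy
    obtain ⟨f, hf, hfz⟩ := hmem x z hx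
    obtain ⟨f', hf', hfz'⟩ := hmem y z hy
    refine hκB _ _ ?_
    rintro ⟨c, hc, hcz⟩
    refine h f hf c hc f' hf' ?_
    rw [fiberPoint_inv_mul] at hcz
    have h1 := mk_inl_eq_of_mk_eq hK hcz
    rw [mk_inl_inv_mul_eq hK _ _ f f' z hfz hfz', map_mul, map_mul, hxy] at h1
    rw [map_mul, map_mul, h1, map_inv, map_inv]
    group

/-- Uniform kernels pass from `H` to a semidirect product of `H` with an amenable group. -/
theorem HasUniformKernels.semidirectProduct (hG : Group.IsAmenable G)
    {N : ℕ → FiniteIndexNormalSubgroup H} {M : ℕ → FiniteIndexNormalSubgroup G}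
    {K : ℕ → FiniteIndexNormalSubgroup (H ⋊[φ] G)}
    (hK : ∀ i x, x ∈ (K i).toSubgroup ↔ x.left ∈ (N i).toSubgroup ∧ x.right ∈ (M i).toSubgroup)
    (hN : HasUniformKernels N) : HasUniformKernels K := by
  classical
  intro A hA ε hε
  -- The Følner set is fixed before `i`, which makes `B` uniform. The weights cost `ε / 2` and the
  -- kernel on `H` another `ε / 2`.
  obtain ⟨F₀, hF₀, hF₀n, hF₀A⟩ := hG (right '' A) (hA.image _) ε hε
  obtain ⟨F, rfl⟩ := hF₀.exists_finset_coe
  have hF : F.Nonempty := hF₀n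
  let c : G × (H ⋊[φ] G) × G → H := fun p => ((inr p.1)⁻¹ * p.2.1 * inr p.2.2).left
  obtain ⟨B, hB, hBk⟩ := hN (c '' ((F : Set G) ×ˢ A ×ˢ (F : Set G)))
    ((F.finite_toSet.prod (hA.prod F.finite_toSet)).image _) (ε / 2) (by positivity)
  let b : G × H × G → H ⋊[φ] G := fun p => inr p.1 * inl p.2.1 * (inr p.2.2)⁻¹
  refine ⟨b '' ((F : Set G) ×ˢ B ×ˢ (F : Set G)),
    (F.finite_toSet.prod (hB.prod F.finite_toSet)).image _, fun i => ?_⟩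
  obtain ⟨κ, hκ, hκ1, hκA, hκB⟩ := hBk i
  obtain ⟨k, hk, hk1, hkA, hkB⟩ := exists_kernel_semidirectProduct (hK i) hF (A := A) (B := B)
    (δ := ε) (δ' := ε / 2) (by positivity) (fun s hs => by
      have := hF₀A s.right ⟨s, hs, rfl⟩
      rwa [← coe_smul_finset, ← coe_symmDiff, Set.ncard_coe_finset, Set.ncard_coe_finset] at this)
    hκ hκ1 (fun u v ⟨f, hf, s, hs, f', hf', h⟩ =>
      hκA u v ⟨_, ⟨(f, s, f'), ⟨hf, hs, hf'⟩, rfl⟩, h.symm⟩) hκB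
  refine ⟨k, hk, hk1, fun x y hxy => ?_, fun x y hxy => hkB x y fun f hf c hc f' hf' h => ?_⟩
  · have := hkA x y hxy
    linarith
  · exact hxy ⟨_, ⟨(f, c, f'), ⟨hf, hc, hf'⟩, rfl⟩, h.symm⟩

end SemidirectProduct

/-! ### The main theorem -/

theorem mainTheorem1 {H G : Type*} [Group H] [Group G]
    [Group.FG H] [Group.FG G] [Group.ResiduallyFinite H] [Group.ResiduallyFinite G]
    (hG : Group.IsAmenable G) (φ : G →* MulAut H)
    (N : ℕ → FiniteIndexNormalSubgroup H)
    (hNchar : ∀ i, (N i).toSubgroup.Characteristic)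
    (hNnested : Antitone N)
    (hNtriv : ⨅ i, (N i).toSubgroup = ⊥)
    (hNbox : ∃ (S : Set H) (gap : ℕ → ℝ) (_ : S.Finite) (hS : Subgroup.closure S = ⊤)
      (hgap : IsBoxGap N S gap), CoarselyEmbedsIntoHilbert (BoxSpace N S gap hS hgap)) :
    ∃ K : ℕ → FiniteIndexNormalSubgroup (H ⋊[φ] G),
      Antitone K ∧ ⨅ i, (K i).toSubgroup = ⊥ ∧
      ∀ (T : Set (H ⋊[φ] G)) (gap : ℕ → ℝ) (_ : T.Finite) (hT : Subgroup.closure T = ⊤)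
        (hgap : IsBoxGap K T gap), CoarselyEmbedsIntoHilbert (BoxSpace K T gap hT hgap) := by
  obtain ⟨S, gap, hfin, hS, hgap, hbox⟩ := hNbox
  have := Group.countable_of_fg G
  obtain ⟨M, hMnested, hMtriv⟩ := Group.ResiduallyFinite.exists_antitone_iInf_eq_bot G
  choose P hP using fun i => exists_finiteIndexNormalSubgroup_act_trivially φ (N i) (hNchar i)
  -- `P i` makes the subgroup normal; `M i` is needed as well because the `P i` intersect in the
  -- kernel of `φ`, which may be nontrivial.
  choose K hK using fun i => exists_finiteIndexNormalSubgroup_semidirectProduct φ (N i) (hNchar i)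
    (M i ⊓ P i) fun g hg => (hP i g).1 hg.2
  have hPnested : Antitone P := fun i j hij g hg =>
    (hP i g).2 fun h => hNnested hij ((hP j g).1 hg h)
  refine ⟨K, fun i j hij x hx => ?_, ?_, fun T gap' hTfin hT hgap' => ?_⟩
  · have hx' := (hK j x).1 hx
    exact (hK i x).2 ⟨hNnested hij hx'.1, hMnested hij hx'.2.1, hPnested hij hx'.2.2⟩
  · rw [eq_bot_iff]
    intro x hx
    have hx' := fun i => (hK i x).1 (Subgroup.mem_iInf.1 hx i)
    have h1 : x.left ∈ ⨅ i, (N i).toSubgroup := Subgroup.mem_iInf.2 fun i => (hx' i).1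
    have h2 : x.right ∈ ⨅ i, (M i).toSubgroup := Subgroup.mem_iInf.2 fun i => (hx' i).2.1
    rw [hNtriv, Subgroup.mem_bot] at h1
    rw [hMtriv, Subgroup.mem_bot] at h2
    exact Subgroup.mem_bot.2 (SemidirectProduct.ext h1 h2)
  · exact ((HasUniformKernels.of_coarselyEmbedsIntoHilbert hfin hbox).semidirectProduct hG
      hK).coarselyEmbedsIntoHilbert hTfin hT hgap'
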